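/- All recursive functions below are total recursive functions of natural-number arguments with natural-number values. A family of rationals $(r_i)$, indexed by $\mathbb N$ or by tuples of natural numbers, is recursive if $r_i=(-1)^{s(i)}a(i)/b(i)$ with recursive $s,a,b$ and $b(i)\neq 0$ for all $i$. A sequence (or double sequence) of reals $(x_i)$ is computable if there is a recursive family of rationals $(r_{i,k})$ with $|x_i-r_{i,k}|\le 2^{-k}$ for all $i,k$; a sequence (or double sequence) of complex numbers $(z_i)$ is computable if there are recursive families of rationals $(p_{i,k})$, $(q_{i,k})$ with $|z_i-(p_{i,k}+\mathrm{i}\,q_{i,k})|\le 2^{-k}$ for all $i,k$. A sequence $\{f_n\}$ of real-valued or complex-valued functions on $\mathbb R$ is computable if (i) the double sequence $\{f_n(x_m)\}$ is computable for every computable sequence of reals $\{x_m\}$, and (ii) there is a recursive function $\alpha(n,L,k)$ such that, for all $n,L,k\in\mathbb N$ and $x,y\in\mathbb R$, $|x|,|y|\le L$ and $|x-y|<2^{-\alpha(n,L,k)}$ imply $|f_n(x)-f_n(y)|<2^{-k}$. A computable sequence $\{f_n\}$ of real-valued functions has compact support $L(n)$ if $L$ is a recursive function with $f_n(x)=0$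 whenever $|x|\ge L(n)$. A sequence $\{\mu_m\}$ of probability distributions (Borel probability measures on $\mathbb R$) is computable if the double sequence $\bigl\{\int_{\mathbb R}f_n\,d\mu_m\bigr\}$ is computable for every computable sequence $\{f_n\}$ of real-valued functions with compact support $L(n)$. **Theorem.** Let $\{\mu_m\}$ be a sequence of probability distributions, and let $\varphi_m(t)=\int_{\mathbb R}e^{\mathrm{i}tx}\,\mu_m(dx)$ be the corresponding characteristic functions. If the sequence $\{\varphi_m\}$ is computable, then the sequence $\{\mu_m\}$ is computable. -/

import Mathlib

/-- A family of rational numbers is recursive if its signs, numerators and (nonzero) denominators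
are given by recursive functions of the index. -/
def RecursiveRat {ι : Type*} [Primcodable ι] (r : ι → ℚ) : Prop :=
  ∃ s a b : ι → ℕ, Computable s ∧ Computable a ∧ Computable b ∧
    (∀ i, b i ≠ 0) ∧ ∀ i, r i = (-1) ^ s i * ((a i : ℚ) / (b i : ℚ))

/-- A sequence of real numbers (`ι = ℕ`), or a double sequence (`ι = ℕ × ℕ`), is computable if a
recursive family of rationals approximates its terms with error at most `2 ^ (-k)`. -/
def ComputableReals {ι : Type*} [Primcodable ι] (x : ι → ℝ) : Prop :=
  ∃ r : ι × ℕ → ℚ, RecursiveRat r ∧ ∀ i k, |x i - (r (i, k) : ℝ)| ≤ (2 ^ k)⁻¹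

/-- A sequence or double sequence of complex numbers is computable if a recursive family of
complex numbers with rational real and imaginary parts approximates its terms with error at most
`2 ^ (-k)`. -/
def ComputableComplexes {ι : Type*} [Primcodable ι] (z : ι → ℂ) : Prop :=
  ∃ p q : ι × ℕ → ℚ, RecursiveRat p ∧ RecursiveRat q ∧
    ∀ i k, ‖z i - ((p (i, k) : ℂ) + (q (i, k) : ℂ) * Complex.I)‖ ≤ (2 ^ k)⁻¹

/-- Effective continuity of a sequence of functions on the real line, locally uniformly in the
argument: there is a recursive modulus of continuity `α (n, L, k)` on each `[-L, L]`. -/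
def EffectivelyContinuous {E : Type*} [NormedAddCommGroup E] (f : ℕ → ℝ → E) : Prop :=
  ∃ α : ℕ × ℕ × ℕ → ℕ, Computable α ∧
    ∀ n L k : ℕ, ∀ x y : ℝ, |x| ≤ L → |y| ≤ L →
      |x - y| < (2 ^ α (n, L, k))⁻¹ → ‖f n x - f n y‖ < (2 ^ k)⁻¹

/-- Computability of a sequence of real functions on the real line: sequential computability
together with effective continuity. -/
def ComputableRealFunctions (f : ℕ → ℝ → ℝ) : Prop :=
  (∀ x : ℕ → ℝ, ComputableReals x → ComputableReals fun p : ℕ × ℕ => f p.1 (x p.2)) ∧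
    EffectivelyContinuous f

/-- Computability of a sequence of complex functions on the real line: sequential computability
together with effective continuity. -/
def ComputableComplexFunctions (f : ℕ → ℝ → ℂ) : Prop :=
  (∀ x : ℕ → ℝ, ComputableReals x → ComputableComplexes fun p : ℕ × ℕ => f p.1 (x p.2)) ∧
    EffectivelyContinuous f

/-- A computable sequence of functions with compact support, with a recursive bound `L` of the
supports. -/
def ComputableCompactSupport (f : ℕ → ℝ → ℝ) (L : ℕ → ℕ) : Prop :=
  ComputableRealFunctions f ∧ Computable L ∧ ∀ n x, (L n : ℝ) ≤ |x| → f n x = 0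

/-- Computability of a sequence of probability distributions: the double sequence of integrals
`μ_m (f_n)` is computable for every computable sequence `f` with compact support. -/
def ComputableDistributions (μ : ℕ → MeasureTheory.Measure ℝ) : Prop :=
  ∀ (f : ℕ → ℝ → ℝ) (L : ℕ → ℕ), ComputableCompactSupport f L →
    ComputableReals fun p : ℕ × ℕ => ∫ x, f p.2 x ∂(μ p.1)

/-! The characteristic function gives the integrals of trigonometric functions, so a compactly
supported `f n` is replaced by a periodic function with an explicit, fast cosine series. Interpolate
`f n` piecewise linearly on a grid of mesh `1 / D`, and replace each tent of the interpolant by its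
periodic version of period `2πR`. The Fourier coefficients of a tent decay like `1 / (n + 1) ^ 2`,
so its integral against `μ m` is an effectively convergent series in the values of `charFun (μ m)`
at rational points. These are computable uniformly in all parameters
(`computableReals_integral_periodicInterpolant`).

Three errors must be controlled effectively. The mesh comes from the modulus of continuity of `f n`
(`abs_sub_gridInterpolant_le`). For `|x| ≤ πR` the periodic and plain interpolants agree
(`periodicInterpolant_eq_gridInterpolant`). Beyond that both functions are bounded by a recursive `M
n`, and the mass of the tail is bounded through the modulus of `charFun (μ m)` at `0`, where its
value is `1` (`measureReal_abs_gt_le_of_charFun`). This effective tightness is what makes `R`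
recursive. -/

section Naturals

/-! ### Recursive arithmetic on naturals and on codes of rationals. -/

variable {ι : Type*} [Primcodable ι] {f g : ι → ℕ}

theorem Computable.fun_nat_add (hf : Computable f) (hg : Computable g) :
    Computable fun i => f i + g i :=
  Primrec.nat_add.to_comp.comp hf hg

theorem Computable.fun_nat_mul (hf : Computable f) (hg : Computable g) :
    Computable fun i => f i * g i :=
  Primrec.nat_mul.to_comp.comp hf hg

theorem Computable.fun_nat_sub (hf : Computable f) (hg : Computable g) :
    Computable fun i => f i - g i :=
  Primrec.nat_sub.to_comp.comp hf hg

theorem Computable.fun_nat_mod (hf : Computable f) (hg : Computable g) :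
    Computable fun i => f i % g i :=
  Primrec.nat_mod.to_comp.comp hf hg

theorem Computable.fun_nat_pow (hf : Computable f) (hg : Computable g) :
    Computable fun i => f i ^ g i := by
  have h : Computable fun i => Nat.rec (motive := fun _ => ℕ) 1 (fun _ y => y * f i) (g i) :=
    Computable.nat_rec (h := fun i (p : ℕ × ℕ) => p.2 * f i) hg (Computable.const 1)
      (Computable.fun_nat_mul (Computable.snd.comp Computable.snd)
        (hf.comp Computable.fst)).to₂
  refine h.of_eq fun i => ?_
  induction g i with
  | zero => simp
  | succ n ih => rw [pow_succ, ← ih]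

end Naturals

/-- The rational `(p - q) / (d + 1)` coded by the triple `(p, q, d)`. -/
def ratOfCode (c : ℕ × ℕ × ℕ) : ℚ := ((c.1 : ℚ) - c.2.1) / (c.2.2 + 1)

/-- Addition of codes of rationals. -/
def ratCodeAdd (c e : ℕ × ℕ × ℕ) : ℕ × ℕ × ℕ :=
  (c.1 * (e.2.2 + 1) + e.1 * (c.2.2 + 1), c.2.1 * (e.2.2 + 1) + e.2.1 * (c.2.2 + 1),
    c.2.2 * e.2.2 + c.2.2 + e.2.2)

/-- Multiplication of codes of rationals. -/
def ratCodeMul (c e : ℕ × ℕ × ℕ) : ℕ × ℕ × ℕ :=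
  (c.1 * e.1 + c.2.1 * e.2.1, c.1 * e.2.1 + c.2.1 * e.1, c.2.2 * e.2.2 + c.2.2 + e.2.2)

theorem ratOfCode_add (c e : ℕ × ℕ × ℕ) :
    ratOfCode (ratCodeAdd c e) = ratOfCode c + ratOfCode e := by
  have h1 : (c.2.2 : ℚ) + 1 ≠ 0 := by positivity
  have h2 : (e.2.2 : ℚ) + 1 ≠ 0 := by positivity
  have h3 : (c.2.2 : ℚ) * e.2.2 + c.2.2 + e.2.2 + 1 = (c.2.2 + 1) * (e.2.2 + 1) := by ring
  simp only [ratOfCode, ratCodeAdd]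
  push_cast
  rw [h3]
  field_simp
  ring

theorem ratOfCode_mul (c e : ℕ × ℕ × ℕ) :
    ratOfCode (ratCodeMul c e) = ratOfCode c * ratOfCode e := by
  have h1 : (c.2.2 : ℚ) + 1 ≠ 0 := by positivity
  have h2 : (e.2.2 : ℚ) + 1 ≠ 0 := by positivity
  have h3 : (c.2.2 : ℚ) * e.2.2 + c.2.2 + e.2.2 + 1 = (c.2.2 + 1) * (e.2.2 + 1) := by ring
  simp only [ratOfCode, ratCodeMul]
  push_cast
  rw [h3]
  field_simp
  ring

theorem abs_ratOfCode_le (c : ℕ × ℕ × ℕ) : |ratOfCode c| ≤ (c.1 + c.2.1 : ℕ) := by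
  rw [ratOfCode, abs_div, abs_of_pos (by positivity : (0 : ℚ) < c.2.2 + 1)]
  refine (div_le_self (abs_nonneg _) (by simp)).trans ?_
  push_cast
  rw [abs_le]
  constructor <;> linarith [Nat.cast_nonneg (α := ℚ) c.1, Nat.cast_nonneg (α := ℚ) c.2.1]

section Codes

variable {ι : Type*} [Primcodable ι] {c e : ι → ℕ × ℕ × ℕ}

theorem Computable.fst_code (hc : Computable c) : Computable fun i => (c i).1 :=
  Computable.fst.comp hc

theorem Computable.snd_code (hc : Computable c) : Computable fun i => (c i).2.1 :=
  Computable.fst.comp (Computable.snd.comp hc)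

theorem Computable.third_code (hc : Computable c) : Computable fun i => (c i).2.2 :=
  Computable.snd.comp (Computable.snd.comp hc)

theorem Computable.ratCodeAdd (hc : Computable c) (he : Computable e) :
    Computable fun i => ratCodeAdd (c i) (e i) := by
  have one : Computable fun _ : ι => 1 := Computable.const 1
  exact ((hc.fst_code.fun_nat_mul (he.third_code.fun_nat_add one)).fun_nat_add
      (he.fst_code.fun_nat_mul (hc.third_code.fun_nat_add one))).pair
    (((hc.snd_code.fun_nat_mul (he.third_code.fun_nat_add one)).fun_nat_add
      (he.snd_code.fun_nat_mul (hc.third_code.fun_nat_add one))).pair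
    (((hc.third_code.fun_nat_mul he.third_code).fun_nat_add hc.third_code).fun_nat_add
      he.third_code))

theorem Computable.ratCodeMul (hc : Computable c) (he : Computable e) :
    Computable fun i => ratCodeMul (c i) (e i) :=
  ((hc.fst_code.fun_nat_mul he.fst_code).fun_nat_add
      (hc.snd_code.fun_nat_mul he.snd_code)).pair
    (((hc.fst_code.fun_nat_mul he.snd_code).fun_nat_add
      (hc.snd_code.fun_nat_mul he.fst_code)).pair
    (((hc.third_code.fun_nat_mul he.third_code).fun_nat_add hc.third_code).fun_nat_add
      he.third_code))

end Codes

/-! ### Closure properties of recursive families of rationals. -/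

section RecursiveRat

variable {ι κ : Type*} [Primcodable ι] [Primcodable κ] {r s : ι → ℚ}

/-- In sign-numerator-denominator form, addition needs a case distinction on signs. With differences
of naturals over `d + 1`, sums and products become polynomial formulas, and no nonvanishing
condition has to be carried along. -/
theorem recursiveRat_iff_exists_code :
    RecursiveRat r ↔ ∃ c : ι → ℕ × ℕ × ℕ, Computable c ∧ ∀ i, r i = ratOfCode (c i) := by
  constructor
  · rintro ⟨s, a, b, hs, ha, hb, hb0, hr⟩
    have hs2 : Computable fun i => s i % 2 := hs.fun_nat_mod (Computable.const 2)
    refine ⟨fun i => (a i * (1 - s i % 2), a i * (s i % 2), b i - 1),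
      (ha.fun_nat_mul ((Computable.const 1).fun_nat_sub hs2)).pair
        ((ha.fun_nat_mul hs2).pair (hb.fun_nat_sub (Computable.const 1))), fun i => ?_⟩
    have hb1 : ((b i - 1 : ℕ) : ℚ) + 1 = b i := by
      exact_mod_cast Nat.succ_pred_eq_of_ne_zero (hb0 i)
    rw [hr i, ratOfCode, hb1]
    rcases Nat.even_or_odd (s i) with h | h
    · simp [h.neg_one_pow, Nat.even_iff.1 h]
    · simp [h.neg_one_pow, Nat.odd_iff.1 h, neg_div]
  · rintro ⟨c, hc, hr⟩
    have one : Computable fun _ : ι => 1 := Computable.const 1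
    -- With truncated subtraction the first entry is `1` exactly when the numerator is negative, and
    -- the second is its absolute value.
    refine ⟨fun i => 1 - (1 - ((c i).2.1 - (c i).1)),
      fun i => ((c i).1 - (c i).2.1) + ((c i).2.1 - (c i).1), fun i => (c i).2.2 + 1,
      one.fun_nat_sub (one.fun_nat_sub (hc.snd_code.fun_nat_sub hc.fst_code)),
      (hc.fst_code.fun_nat_sub hc.snd_code).fun_nat_add
        (hc.snd_code.fun_nat_sub hc.fst_code),
      hc.third_code.fun_nat_add one, fun i => Nat.succ_ne_zero _, fun i => ?_⟩
    rw [hr i, ratOfCode]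
    rcases le_or_gt (c i).2.1 (c i).1 with h | h
    · simp [Nat.sub_eq_zero_of_le h, Nat.cast_sub h]
    · have h1 : 1 - ((c i).2.1 - (c i).1) = 0 := by omega
      simp [Nat.sub_eq_zero_of_le h.le, Nat.cast_sub h.le, h1]
      ring

theorem RecursiveRat.comp {r : κ → ℚ} (hr : RecursiveRat r) {g : ι → κ} (hg : Computable g) :
    RecursiveRat fun i => r (g i) := by
  obtain ⟨s, a, b, hs, ha, hb, hb0, h⟩ := hr
  exact ⟨_, _, _, hs.comp hg, ha.comp hg, hb.comp hg, fun i => hb0 _, fun i => h _⟩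

theorem RecursiveRat.of_eq (hr : RecursiveRat r) (h : ∀ i, r i = s i) : RecursiveRat s :=
  (funext h : r = s) ▸ hr

theorem recursiveRat_natCast {a : ι → ℕ} (ha : Computable a) :
    RecursiveRat fun i => (a i : ℚ) :=
  recursiveRat_iff_exists_code.2 ⟨fun i => (a i, 0, 0),
    ha.pair (Computable.const (0, 0)), fun i => by simp [ratOfCode]⟩

theorem recursiveRat_inv_natCast_add_one {a : ι → ℕ} (ha : Computable a) :
    RecursiveRat fun i => ((a i : ℚ) + 1)⁻¹ :=
  recursiveRat_iff_exists_code.2 ⟨fun i => (1, 0, a i),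
    (Computable.const 1).pair ((Computable.const 0).pair ha), fun i => by simp [ratOfCode]⟩

theorem recursiveRat_neg_one_pow {a : ι → ℕ} (ha : Computable a) :
    RecursiveRat fun i => (-1 : ℚ) ^ a i :=
  ⟨a, fun _ => 1, fun _ => 1, ha, Computable.const 1, Computable.const 1, by simp, by simp⟩

theorem RecursiveRat.add (hr : RecursiveRat r) (hs : RecursiveRat s) :
    RecursiveRat fun i => r i + s i := by
  obtain ⟨c, hc, hr⟩ := recursiveRat_iff_exists_code.1 hr
  obtain ⟨e, he, hs⟩ := recursiveRat_iff_exists_code.1 hs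
  exact recursiveRat_iff_exists_code.2 ⟨_, hc.ratCodeAdd he, fun i => by
    rw [ratOfCode_add, hr, hs]⟩

theorem RecursiveRat.mul (hr : RecursiveRat r) (hs : RecursiveRat s) :
    RecursiveRat fun i => r i * s i := by
  obtain ⟨c, hc, hr⟩ := recursiveRat_iff_exists_code.1 hr
  obtain ⟨e, he, hs⟩ := recursiveRat_iff_exists_code.1 hs
  exact recursiveRat_iff_exists_code.2 ⟨_, hc.ratCodeMul he, fun i => by
    rw [ratOfCode_mul, hr, hs]⟩

theorem RecursiveRat.neg (hr : RecursiveRat r) : RecursiveRat fun i => -r i :=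
  ((recursiveRat_neg_one_pow (Computable.const 1)).mul hr).of_eq fun i => by simp

theorem RecursiveRat.sub (hr : RecursiveRat r) (hs : RecursiveRat s) :
    RecursiveRat fun i => r i - s i :=
  (hr.add hs.neg).of_eq fun i => by ring

theorem RecursiveRat.sum_range {r : ι × ℕ → ℚ} (hr : RecursiveRat r) {N : ι → ℕ}
    (hN : Computable N) : RecursiveRat fun i => ∑ j ∈ Finset.range (N i), r (i, j) := by
  obtain ⟨c, hc, hr⟩ := recursiveRat_iff_exists_code.1 hr
  refine recursiveRat_iff_exists_code.2
    ⟨fun i => Nat.rec (motive := fun _ => ℕ × ℕ × ℕ) (0, 0, 0)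
      (fun j y => ratCodeAdd y (c (i, j))) (N i),
    Computable.nat_rec (h := fun i (p : ℕ × ℕ × ℕ × ℕ) => ratCodeAdd p.2 (c (i, p.1))) hN
      (Computable.const _) ?_, fun i => ?_⟩
  · exact Computable.ratCodeAdd (Computable.snd.comp Computable.snd)
      (hc.comp (Computable.fst.pair (Computable.fst.comp Computable.snd)))
  · simp only
    induction N i with
    | zero => simp [ratOfCode]
    | succ n ih => rw [Finset.sum_range_succ, ih, ratOfCode_add, hr]

theorem RecursiveRat.prod_range {r : ι × ℕ → ℚ} (hr : RecursiveRat r) {N : ι → ℕ}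
    (hN : Computable N) : RecursiveRat fun i => ∏ j ∈ Finset.range (N i), r (i, j) := by
  obtain ⟨c, hc, hr⟩ := recursiveRat_iff_exists_code.1 hr
  refine recursiveRat_iff_exists_code.2
    ⟨fun i => Nat.rec (motive := fun _ => ℕ × ℕ × ℕ) (1, 0, 0)
      (fun j y => ratCodeMul y (c (i, j))) (N i),
    Computable.nat_rec (h := fun i (p : ℕ × ℕ × ℕ × ℕ) => ratCodeMul p.2 (c (i, p.1))) hN
      (Computable.const _) ?_, fun i => ?_⟩
  · exact Computable.ratCodeMul (Computable.snd.comp Computable.snd)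
      (hc.comp (Computable.fst.pair (Computable.fst.comp Computable.snd)))
  · simp only
    induction N i with
    | zero => simp [ratOfCode]
    | succ n ih => rw [Finset.prod_range_succ, ih, ratOfCode_mul, hr]

theorem RecursiveRat.exists_natCast_bound (hr : RecursiveRat r) :
    ∃ A : ι → ℕ, Computable A ∧ ∀ i, |r i| ≤ A i := by
  obtain ⟨c, hc, hr⟩ := recursiveRat_iff_exists_code.1 hr
  exact ⟨_, hc.fst_code.fun_nat_add hc.snd_code, fun i => by
    rw [hr]; exact abs_ratOfCode_le _⟩

/-- The terms of an exponential series at recursive rationals form a recursive family. -/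
theorem RecursiveRat.pow_div_factorial (hr : RecursiveRat r) {N : ι → ℕ} (hN : Computable N) :
    RecursiveRat fun i => r i ^ N i / (N i).factorial := by
  refine (RecursiveRat.prod_range (r := fun p : ι × ℕ => r p.1 * ((p.2 : ℚ) + 1)⁻¹)
    ((hr.comp Computable.fst).mul (recursiveRat_inv_natCast_add_one Computable.snd)) hN).of_eq
    fun i => ?_
  simp only
  rw [Finset.prod_mul_distrib, Finset.prod_const, Finset.card_range, Finset.prod_inv_distrib,
    ← Finset.prod_range_add_one_eq_factorial]
  push_cast
  rfl

end RecursiveRat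

/-! ### Computable families of reals: arithmetic, effective limits, `cos`, `sin` and `1 / π`. -/

section ComputableReals

variable {ι κ : Type*} [Primcodable ι] [Primcodable κ] {x y : ι → ℝ}

/-- Since `N ≤ 2 ^ N`, asking for `N` more bits of precision absorbs an error factor `N`, without
logarithms. -/
theorem Nat.cast_mul_inv_two_pow_add_le (N k : ℕ) :
    (N : ℝ) * (2 ^ (k + N))⁻¹ ≤ (2 ^ k)⁻¹ := by
  have h : (N : ℝ) ≤ 2 ^ N := by exact_mod_cast Nat.lt_two_pow_self.le
  rw [pow_add, mul_inv, mul_left_comm]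
  refine mul_le_of_le_one_right (by positivity) ?_
  rw [← div_eq_mul_inv]
  exact (div_le_one (by positivity)).2 h

theorem ComputableReals.of_eq (hx : ComputableReals x) (h : ∀ i, x i = y i) :
    ComputableReals y :=
  (funext h : x = y) ▸ hx

theorem ComputableReals.comp {x : κ → ℝ} (hx : ComputableReals x) {g : ι → κ}
    (hg : Computable g) : ComputableReals fun i => x (g i) := by
  obtain ⟨r, hr, h⟩ := hx
  exact ⟨fun p => r (g p.1, p.2), hr.comp ((hg.comp Computable.fst).pair Computable.snd),
    fun i k => h _ _⟩

theorem RecursiveRat.computableReals {r : ι → ℚ} (hr : RecursiveRat r) :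
    ComputableReals fun i => (r i : ℝ) :=
  ⟨fun p => r p.1, hr.comp Computable.fst, fun i k => by simp⟩

theorem computableReals_natCast {a : ι → ℕ} (ha : Computable a) :
    ComputableReals fun i => (a i : ℝ) :=
  (recursiveRat_natCast ha).computableReals.of_eq fun i => by simp

theorem ComputableReals.exists_natCast_bound (hx : ComputableReals x) :
    ∃ A : ι → ℕ, Computable A ∧ ∀ i, |x i| ≤ A i := by
  obtain ⟨r, hr, h⟩ := hx
  obtain ⟨A, hA, hrA⟩ := hr.exists_natCast_bound
  refine ⟨fun i => A (i, 0) + 1, (hA.comp (Computable.id.pair (Computable.const 0))).fun_nat_add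
    (Computable.const 1), fun i => ?_⟩
  have h1 := h i 0
  have h2 : |(r (i, 0) : ℝ)| ≤ A (i, 0) := by exact_mod_cast hrA (i, 0)
  have h3 := abs_sub_abs_le_abs_sub (x i) (r (i, 0))
  push_cast
  norm_num at h1
  linarith

theorem ComputableReals.add (hx : ComputableReals x) (hy : ComputableReals y) :
    ComputableReals fun i => x i + y i := by
  obtain ⟨r, hr, hx⟩ := hx
  obtain ⟨s, hs, hy⟩ := hy
  have hc : Computable fun p : ι × ℕ => (p.1, p.2 + 1) :=
    Computable.fst.pair (Computable.succ.comp Computable.snd)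
  refine ⟨_, (hr.comp hc).add (hs.comp hc), fun i k => ?_⟩
  have h1 := hx i (k + 1)
  have h2 := hy i (k + 1)
  have h3 : ((2 : ℝ) ^ (k + 1))⁻¹ = (2 ^ k)⁻¹ / 2 := by rw [pow_succ, mul_inv]; ring
  push_cast
  rw [add_sub_add_comm]
  refine (abs_add_le _ _).trans ?_
  linarith

theorem ComputableReals.mul (hx : ComputableReals x) (hy : ComputableReals y) :
    ComputableReals fun i => x i * y i := by
  obtain ⟨A, hA, hxA⟩ := hx.exists_natCast_bound
  obtain ⟨B, hB, hyB⟩ := hy.exists_natCast_bound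
  obtain ⟨r, hr, hx⟩ := hx
  obtain ⟨s, hs, hy⟩ := hy
  -- At precision `ε ≤ 1` the error of the product is at most `(A + B + 1) * ε`, because the
  -- approximation of `y` is bounded by `B + 1`.
  have hc : Computable fun p : ι × ℕ => (p.1, p.2 + (A p.1 + B p.1 + 1)) :=
    Computable.fst.pair (Computable.snd.fun_nat_add (((hA.comp Computable.fst).fun_nat_add
      (hB.comp Computable.fst)).fun_nat_add (Computable.const 1)))
  refine ⟨_, (hr.comp hc).mul (hs.comp hc), fun i k => ?_⟩
  refine le_trans ?_ (Nat.cast_mul_inv_two_pow_add_le (A i + B i + 1) k)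
  have h1 := hx i (k + (A i + B i + 1))
  have h2 := hy i (k + (A i + B i + 1))
  have hxA := hxA i
  have hyB := hyB i
  push_cast
  set u : ℝ := ((r (i, k + (A i + B i + 1)) : ℚ) : ℝ)
  set v : ℝ := ((s (i, k + (A i + B i + 1)) : ℚ) : ℝ)
  set ε : ℝ := (2 ^ (k + (A i + B i + 1)))⁻¹
  have hε : ε ≤ 1 := inv_le_one_of_one_le₀ (one_le_pow₀ one_le_two)
  have hv : |v| ≤ B i + 1 := by
    have := abs_sub_abs_le_abs_sub v (y i)
    rw [abs_sub_comm] at this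
    linarith
  calc |x i * y i - u * v| = |x i * (y i - v) + (x i - u) * v| := by ring_nf
    _ ≤ |x i| * |y i - v| + |x i - u| * |v| := by
      rw [← abs_mul, ← abs_mul]; exact abs_add_le _ _
    _ ≤ A i * ε + ε * (B i + 1) := by gcongr
    _ = _ := by ring

theorem ComputableReals.neg (hx : ComputableReals x) : ComputableReals fun i => -x i := by
  obtain ⟨r, hr, hx⟩ := hx
  refine ⟨_, hr.neg, fun i k => ?_⟩
  push_cast
  rw [neg_sub_neg, abs_sub_comm]
  exact hx i k

theorem ComputableReals.sub (hx : ComputableReals x) (hy : ComputableReals y) :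
    ComputableReals fun i => x i - y i :=
  (hx.add hy.neg).of_eq fun i => by ring

theorem ComputableReals.sum_range {x : ι × ℕ → ℝ} (hx : ComputableReals x) {N : ι → ℕ}
    (hN : Computable N) : ComputableReals fun i => ∑ j ∈ Finset.range (N i), x (i, j) := by
  obtain ⟨r, hr, hx⟩ := hx
  have hN1 : Computable fun p : ι × ℕ => N p.1 := hN.comp Computable.fst
  refine ⟨_, RecursiveRat.sum_range (r := fun p : (ι × ℕ) × ℕ =>
    r ((p.1.1, p.2), p.1.2 + N p.1.1)) (hr.comp (((Computable.fst.comp Computable.fst).pair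
      Computable.snd).pair ((Computable.snd.comp Computable.fst).fun_nat_add
      (hN1.comp Computable.fst)))) hN1, fun i k => ?_⟩
  refine le_trans ?_ (Nat.cast_mul_inv_two_pow_add_le (N i) k)
  push_cast
  rw [← Finset.sum_sub_distrib]
  refine (Finset.abs_sum_le_sum_abs _ _).trans ((Finset.sum_le_sum fun j _ => hx (i, j) _).trans ?_)
  simp

/-- Effective limits of computable families are computable. -/
theorem ComputableReals.of_effective_limit {x : ι × ℕ → ℝ} (hx : ComputableReals x)
    (h : ∀ i k, |y i - x (i, k)| ≤ (2 ^ k)⁻¹) : ComputableReals y := by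
  obtain ⟨r, hr, hx⟩ := hx
  have hs : Computable fun p : ι × ℕ => p.2 + 1 := Computable.succ.comp Computable.snd
  refine ⟨_, hr.comp ((Computable.fst.pair hs).pair hs), fun i k => ?_⟩
  have h1 := hx (i, k + 1) (k + 1)
  have h2 := h i (k + 1)
  have h3 : ((2 : ℝ) ^ (k + 1))⁻¹ = (2 ^ k)⁻¹ / 2 := by rw [pow_succ, mul_inv]; ring
  have h4 := abs_sub_le (y i) (x (i, k + 1)) (r ((i, k + 1), k + 1))
  simp only
  linarith

theorem ComputableReals.of_limit_rate {x : ι × ℕ → ℝ} (hx : ComputableReals x)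
    {C : ι → ℕ} (hC : Computable C) (h : ∀ i n, |y i - x (i, n)| ≤ C i / (n + 1)) :
    ComputableReals y := by
  -- At the index `n = C * 2 ^ k` the bound `C / (n + 1)` is at most `2 ^ (-k)`.
  have hg : Computable fun p : ι × ℕ => (p.1, C p.1 * 2 ^ p.2) :=
    Computable.fst.pair ((hC.comp Computable.fst).fun_nat_mul
      ((Computable.const 2).fun_nat_pow Computable.snd))
  refine (hx.comp hg).of_effective_limit fun i k => (h i _).trans ?_
  push_cast
  rw [div_le_iff₀ (by positivity), inv_mul_eq_div, le_div_iff₀ (by positivity)]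
  linarith

/-- The tail is dominated by a telescoping series: `C / (j + 1) ^ 2 ≤ 2 * C / (j + 1) - 2 * C / (j +
2)`. -/
theorem abs_sub_sum_range_le_of_abs_le_div_sq {u : ℕ → ℝ} {s C : ℝ} (hu : HasSum u s)
    (h : ∀ n, |u n| ≤ C / (n + 1) ^ 2) (N : ℕ) :
    |s - ∑ n ∈ Finset.range N, u n| ≤ 2 * C / (N + 1) := by
  have hC : 0 ≤ C := by simpa using (abs_nonneg _).trans (h 0)
  have key : ∀ m, |∑ n ∈ Finset.range (N + m), u n - ∑ n ∈ Finset.range N, u n| ≤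
      2 * C / (N + 1) - 2 * C / (N + m + 1) := by
    intro m
    induction m with
    | zero => simp
    | succ m ih =>
      have h1 := h (N + m)
      rw [← add_assoc, Finset.sum_range_succ, add_sub_right_comm]
      refine (abs_add_le _ _).trans ?_
      have h2 : C / (((N + m : ℕ) : ℝ) + 1) ^ 2 ≤
          2 * C / (N + m + 1) - 2 * C / (N + (m + 1 : ℕ) + 1) := by
        push_cast
        have hp : (0 : ℝ) < N + m + 1 := by positivity
        have hp' : (0 : ℝ) < N + (m + 1) + 1 := by positivity
        rw [div_sub_div _ _ hp.ne' hp'.ne', div_le_div_iff₀ (by positivity) (by positivity)]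
        have e : 2 * C * ((N : ℝ) + (m + 1) + 1) - (N + m + 1) * (2 * C) = 2 * C := by ring
        rw [e]
        have : ((N : ℝ) + (m + 1) + 1) ≤ 2 * (N + m + 1) := by
          linarith [Nat.cast_nonneg (α := ℝ) N, Nat.cast_nonneg (α := ℝ) m]
        nlinarith [mul_le_mul_of_nonneg_left this (mul_nonneg hC hp.le)]
      linarith
  have ht : Filter.Tendsto (fun m => |∑ n ∈ Finset.range (N + m), u n -
      ∑ n ∈ Finset.range N, u n|) Filter.atTop (nhds |s - ∑ n ∈ Finset.range N, u n|) := by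
    refine Filter.Tendsto.abs (Filter.Tendsto.sub_const ?_ _)
    simpa only [add_comm N] using
      (Filter.tendsto_add_atTop_iff_nat N).2 hu.tendsto_sum_nat
  refine le_of_tendsto' ht fun m => (key m).trans ?_
  have : 0 ≤ 2 * C / (N + m + 1) := by positivity
  linarith

theorem ComputableReals.of_hasSum {u : ι × ℕ → ℝ} (hu : ComputableReals u)
    {C : ι → ℕ} (hC : Computable C) (hs : ∀ i, HasSum (fun n => u (i, n)) (y i))
    (h : ∀ i n, |u (i, n)| ≤ C i / (n + 1) ^ 2) : ComputableReals y := by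
  have hx : ComputableReals fun p : ι × ℕ => ∑ n ∈ Finset.range p.2, u (p.1, n) :=
    ComputableReals.sum_range (x := fun p : (ι × ℕ) × ℕ => u (p.1.1, p.2))
      (hu.comp ((Computable.fst.comp Computable.fst).pair Computable.snd)) Computable.snd
  refine hx.of_limit_rate ((Computable.const 2).fun_nat_mul hC) fun i n => ?_
  push_cast
  exact abs_sub_sum_range_le_of_abs_le_div_sq (hs i) (h i) n

/-- Puts the sine and cosine series in the form required by `ComputableReals.of_hasSum`: `(2 * A) ^
N / N! ≤ e ^ (2 * A) ≤ 9 ^ A`, and the spare factor `2 ^ N` dominates `(n + 1) ^ 2`. -/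
theorem pow_div_factorial_le_nine_pow {q : ℝ} {A : ℕ} (hq : |q| ≤ A) (n N : ℕ)
    (hn : 2 * n ≤ N) : |q| ^ N / N.factorial ≤ (9 ^ A : ℕ) / ((n : ℝ) + 1) ^ 2 := by
  have h1 : (2 * A : ℝ) ^ N / N.factorial ≤ 9 ^ A := by
    refine (Real.pow_div_factorial_le_exp (2 * A) (by positivity) N).trans ?_
    rw [mul_comm, Real.exp_nat_mul]
    gcongr
    have h2 : Real.exp 2 = Real.exp 1 ^ 2 := by rw [← Real.exp_nat_mul]; norm_num
    rw [h2]
    nlinarith [Real.exp_one_lt_three, Real.exp_pos 1]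
  have h3 : ((n : ℝ) + 1) ^ 2 ≤ 2 ^ N := by
    have h4 : (n : ℝ) + 1 ≤ 2 ^ n := by exact_mod_cast Nat.lt_two_pow_self
    calc ((n : ℝ) + 1) ^ 2 ≤ (2 ^ n) ^ 2 := by gcongr
      _ = 2 ^ (2 * n) := by rw [← pow_mul, mul_comm]
      _ ≤ 2 ^ N := pow_le_pow_right₀ one_le_two hn
  rw [le_div_iff₀ (by positivity)]
  push_cast
  calc |q| ^ N / N.factorial * ((n : ℝ) + 1) ^ 2 ≤ (A : ℝ) ^ N / N.factorial * 2 ^ N := by gcongr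
    _ = (2 * A : ℝ) ^ N / N.factorial := by rw [mul_pow]; ring
    _ ≤ _ := h1

theorem RecursiveRat.computableReals_cos {q : ι → ℚ} (hq : RecursiveRat q) :
    ComputableReals fun i => Real.cos (q i) := by
  obtain ⟨A, hA, hqA⟩ := hq.exists_natCast_bound
  have hr : RecursiveRat fun p : ι × ℕ =>
      (-1 : ℚ) ^ p.2 * (q p.1 ^ (2 * p.2) / (2 * p.2).factorial) :=
    (recursiveRat_neg_one_pow Computable.snd).mul ((hq.comp Computable.fst).pow_div_factorial
      ((Computable.const 2).fun_nat_mul Computable.snd))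
  refine hr.computableReals.of_hasSum ((Computable.const 9).fun_nat_pow hA) (fun i => ?_)
    fun i n => ?_
  · convert Real.hasSum_cos (q i) using 2 with n
    push_cast
    ring
  · push_cast
    rw [abs_mul, abs_pow, abs_neg, abs_one, one_pow, one_mul, abs_div, abs_pow, Nat.abs_cast]
    simpa using pow_div_factorial_le_nine_pow (q := q i) (A := A i) (by exact_mod_cast hqA i) n
      (2 * n) le_rfl

theorem RecursiveRat.computableReals_sin {q : ι → ℚ} (hq : RecursiveRat q) :
    ComputableReals fun i => Real.sin (q i) := by
  obtain ⟨A, hA, hqA⟩ := hq.exists_natCast_bound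
  have hr : RecursiveRat fun p : ι × ℕ =>
      (-1 : ℚ) ^ p.2 * (q p.1 ^ (2 * p.2 + 1) / (2 * p.2 + 1).factorial) :=
    (recursiveRat_neg_one_pow Computable.snd).mul ((hq.comp Computable.fst).pow_div_factorial
      (((Computable.const 2).fun_nat_mul Computable.snd).fun_nat_add (Computable.const 1)))
  refine hr.computableReals.of_hasSum ((Computable.const 9).fun_nat_pow hA) (fun i => ?_)
    fun i n => ?_
  · convert Real.hasSum_sin (q i) using 2 with n
    push_cast
    ring
  · push_cast
    rw [abs_mul, abs_pow, abs_neg, abs_one, one_pow, one_mul, abs_div, abs_pow, Nat.abs_cast]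
    simpa using pow_div_factorial_le_nine_pow (q := q i) (A := A i) (by exact_mod_cast hqA i) n
      (2 * n + 1) (Nat.le_succ _)

/-- By Wallis' product, `2 * W n` increases to `π`, and the lower bound `(2 * n + 1) / (2 * n + 2) *
(π / 2)` for `W n` gives an error of order `1 / n` for the inverse. -/
theorem computableReals_inv_pi : ComputableReals fun _ : ι => Real.pi⁻¹ := by
  have hr : RecursiveRat fun p : ι × ℕ => (((1 : ℕ) : ℚ) + 1)⁻¹ * ∏ j ∈ Finset.range p.2,
      (((2 * j + 1) * (2 * j + 3) : ℕ) : ℚ) *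
        (((((2 * j + 2) * (2 * j + 2) - 1 : ℕ) : ℕ) : ℚ) + 1)⁻¹ := by
    have h2 : Computable fun p : (ι × ℕ) × ℕ => 2 * p.2 :=
      (Computable.const 2).fun_nat_mul Computable.snd
    have h2a := fun a => h2.fun_nat_add (Computable.const a)
    refine (recursiveRat_inv_natCast_add_one (Computable.const 1)).mul
      (RecursiveRat.prod_range (r := fun p : (ι × ℕ) × ℕ =>
        (((2 * p.2 + 1) * (2 * p.2 + 3) : ℕ) : ℚ) *
          (((((2 * p.2 + 2) * (2 * p.2 + 2) - 1 : ℕ) : ℕ) : ℚ) + 1)⁻¹) ?_ Computable.snd)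
    exact (recursiveRat_natCast ((h2a 1).fun_nat_mul (h2a 3))).mul
      (recursiveRat_inv_natCast_add_one
        (((h2a 2).fun_nat_mul (h2a 2)).fun_nat_sub (Computable.const 1)))
  refine hr.computableReals.of_limit_rate (Computable.const 1) fun i n => ?_
  have hW : (((((1 : ℕ) : ℚ) + 1)⁻¹ * ∏ j ∈ Finset.range n,
      (((2 * j + 1) * (2 * j + 3) : ℕ) : ℚ) *
        (((((2 * j + 2) * (2 * j + 2) - 1 : ℕ) : ℕ) : ℚ) + 1)⁻¹ : ℚ) : ℝ) =
      (2 * Real.Wallis.W n)⁻¹ := by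
    rw [mul_inv, Real.Wallis.W, ← Finset.prod_inv_distrib]
    push_cast
    congr 1
    · norm_num
    · refine Finset.prod_congr rfl fun j _ => ?_
      have : (((2 * j + 2) * (2 * j + 2) - 1 : ℕ) : ℝ) + 1 = (2 * j + 2) * (2 * j + 2) := by
        have h : 1 ≤ (2 * j + 2) * (2 * j + 2) := Nat.one_le_iff_ne_zero.2 (by positivity)
        push_cast [h]
        ring
      rw [this]
      field_simp
  simp only
  rw [hW]
  have h0 := Real.Wallis.W_pos n
  have h1 := Real.Wallis.W_le n
  have h2 := Real.Wallis.le_W n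
  have hπ := Real.pi_gt_three
  have h3 : Real.pi⁻¹ ≤ (2 * Real.Wallis.W n)⁻¹ := by
    gcongr; linarith
  rw [abs_sub_comm, abs_of_nonneg (sub_nonneg.2 h3), Nat.cast_one]
  have h4 : (2 * Real.Wallis.W n)⁻¹ ≤ (2 * (((2 : ℝ) * n + 1) / (2 * n + 2) * (Real.pi / 2)))⁻¹ := by
    gcongr
  have h5 : (2 * (((2 : ℝ) * n + 1) / (2 * n + 2) * (Real.pi / 2)))⁻¹ =
      Real.pi⁻¹ + Real.pi⁻¹ * (2 * (n : ℝ) + 1)⁻¹ := by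
    field_simp
    ring
  have h6 : Real.pi⁻¹ * (2 * (n : ℝ) + 1)⁻¹ ≤ 1 / (n + 1) := by
    rw [← mul_inv, one_div]
    gcongr
    nlinarith [Nat.cast_nonneg (α := ℝ) n]
  linarith

/-- Sequential computability at a recursive family of rational points. -/
theorem ComputableReals.eval_ratCast {f : ℕ → ℝ → ℝ}
    (hf : ∀ x : ℕ → ℝ, ComputableReals x → ComputableReals fun p : ℕ × ℕ => f p.1 (x p.2))
    {n : ι → ℕ} (hn : Computable n) {r : ι → ℚ} (hr : RecursiveRat r) :
    ComputableReals fun i => f (n i) (r i) := by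
  obtain ⟨c, hc, hr⟩ := recursiveRat_iff_exists_code.1 hr
  -- The hypothesis only accepts sequences indexed by `ℕ`. One sequence enumerates all coded
  -- rationals, and any recursive family is then a reindexing of it.
  have hd : Computable fun j : ℕ => ((j.unpair.1, j.unpair.2.unpair) : ℕ × ℕ × ℕ) :=
    (Primrec.fst.comp Primrec.unpair).to_comp.pair
      (Primrec.unpair.comp (Primrec.snd.comp Primrec.unpair)).to_comp
  have hu : RecursiveRat fun j : ℕ => ratOfCode (j.unpair.1, j.unpair.2.unpair) :=
    recursiveRat_iff_exists_code.2 ⟨_, hd, fun _ => rfl⟩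
  have hp : Computable fun i => Nat.pair (c i).1 (Nat.pair (c i).2.1 (c i).2.2) :=
    Primrec₂.natPair.to_comp.comp hc.fst_code
      (Primrec₂.natPair.to_comp.comp hc.snd_code hc.third_code)
  refine ((hf _ hu.computableReals).comp (hn.pair hp)).of_eq fun i => ?_
  simp [hr i]

end ComputableReals

theorem ComputableComplexes.re {ι : Type*} [Primcodable ι] {z : ι → ℂ}
    (hz : ComputableComplexes z) : ComputableReals fun i => (z i).re := by
  obtain ⟨p, q, hp, -, h⟩ := hz
  refine ⟨p, hp, fun i k => le_trans ?_ (h i k)⟩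
  simpa using Complex.abs_re_le_norm (z i - ((p (i, k) : ℂ) + (q (i, k) : ℂ) * Complex.I))

theorem ComputableComplexes.im {ι : Type*} [Primcodable ι] {z : ι → ℂ}
    (hz : ComputableComplexes z) : ComputableReals fun i => (z i).im := by
  obtain ⟨p, q, -, hq, h⟩ := hz
  refine ⟨q, hq, fun i k => le_trans ?_ (h i k)⟩
  simpa using Complex.abs_im_le_norm (z i - ((p (i, k) : ℂ) + (q (i, k) : ℂ) * Complex.I))

/-! ### The periodic tent, its cosine series, and the tents as a partition of unity. -/

section PeriodicTent

/-- This is the Fourier series of the Bernoulli polynomial `B₂`, rescaled to `[0, 2π]`, with the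
vanishing term of index `0` dropped. -/
theorem hasSum_cos_mul_div_sq {θ : ℝ} (h0 : 0 ≤ θ) (h1 : θ ≤ 2 * Real.pi) :
    HasSum (fun n : ℕ => Real.cos ((n + 1) * θ) / ((n : ℝ) + 1) ^ 2)
      (Real.pi ^ 2 / 6 - Real.pi * θ / 2 + θ ^ 2 / 4) := by
  have hπ := Real.pi_pos
  have h := hasSum_one_div_nat_pow_mul_cos (k := 1) one_ne_zero (x := θ / (2 * Real.pi))
    ⟨by positivity, (div_le_one (by positivity)).2 h1⟩
  rw [← hasSum_nat_add_iff' 1] at h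
  have hB : (Polynomial.bernoulli 2) =
      Polynomial.X ^ 2 - Polynomial.X + Polynomial.C (1 / 6 : ℚ) := by
    simp [Polynomial.bernoulli, Finset.sum_range_succ, bernoulli_two, bernoulli_one,
      Nat.choose, ← Polynomial.C_mul_X_pow_eq_monomial]
    have e : Polynomial.C (-1 / 2 : ℚ) * 2 = -1 := by
      rw [← Polynomial.C_ofNat, ← Polynomial.C_mul]
      norm_num
    linear_combination Polynomial.X * e
  convert! h using 1
  · funext n
    have e : 2 * Real.pi * ((n + 1 : ℕ) : ℝ) * (θ / (2 * Real.pi)) = (n + 1) * θ := by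
      push_cast
      field_simp
    rw [e]
    push_cast
    ring
  · rw [mul_one, hB]
    simp [Nat.factorial]
    field_simp
    ring

theorem hasSum_cos_mul_div_sq_of_abs_le {θ : ℝ} (h : |θ| ≤ 2 * Real.pi) :
    HasSum (fun n : ℕ => Real.cos ((n + 1) * θ) / ((n : ℝ) + 1) ^ 2)
      (Real.pi ^ 2 / 6 - Real.pi * |θ| / 2 + θ ^ 2 / 4) := by
  have h' := hasSum_cos_mul_div_sq (abs_nonneg θ) h
  rw [sq_abs] at h'
  convert h' using 3 with n
  rcases abs_choice θ with e | e <;> rw [e]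
  rw [mul_neg, Real.cos_neg]

/-- The `n`-th term of the cosine series of the `2π`-periodic tent of half-width `δ`. -/
noncomputable def tentTerm (δ : ℝ) (n : ℕ) (θ : ℝ) : ℝ :=
  (2 - 2 * Real.cos ((n + 1) * δ)) / ((n : ℝ) + 1) ^ 2 * Real.cos ((n + 1) * θ)

/-- The `2π`-periodic function that equals `max 0 (δ - |θ|)` near the origin, as a cosine
series. -/
noncomputable def periodicTent (δ θ : ℝ) : ℝ :=
  Real.pi⁻¹ * (δ ^ 2 / 2 + ∑' n, tentTerm δ n θ)

/-- The piecewise linear tent of half-width and height one. -/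
noncomputable def linearTent (u : ℝ) : ℝ := (|u + 1| + |u - 1| - 2 * |u|) / 2

theorem abs_tentTerm_le (δ : ℝ) (n : ℕ) (θ : ℝ) :
    |tentTerm δ n θ| ≤ 4 / ((n : ℝ) + 1) ^ 2 := by
  rw [tentTerm, abs_mul, abs_div, abs_of_pos (by positivity : (0 : ℝ) < ((n : ℝ) + 1) ^ 2)]
  refine (mul_le_of_le_one_right (by positivity) (Real.abs_cos_le_one _)).trans ?_
  gcongr
  rw [abs_le]
  constructor <;> linarith [Real.neg_one_le_cos ((n + 1) * δ), Real.cos_le_one ((n + 1) * δ)]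

theorem summable_const_div_add_one_sq (C : ℝ) :
    Summable fun n : ℕ => C / ((n : ℝ) + 1) ^ 2 := by
  have h := (summable_nat_add_iff 1).2 (Real.summable_one_div_nat_pow.2 one_lt_two)
  refine (h.mul_left C).congr fun n => ?_
  push_cast
  ring

theorem abs_tsum_tentTerm_le (δ θ : ℝ) :
    |∑' n, tentTerm δ n θ| ≤ ∑' n : ℕ, 4 / ((n : ℝ) + 1) ^ 2 :=
  (Real.norm_eq_abs _).symm.trans_le (tsum_of_norm_bounded
    (summable_const_div_add_one_sq 4).hasSum fun n =>
      (Real.norm_eq_abs _).trans_le (abs_tentTerm_le δ n θ))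

theorem continuous_tentTerm (δ : ℝ) (n : ℕ) : Continuous (tentTerm δ n) := by
  unfold tentTerm
  fun_prop

theorem continuous_periodicTent (δ : ℝ) : Continuous (periodicTent δ) :=
  continuous_const.mul (continuous_const.add (continuous_tsum (continuous_tentTerm δ)
    (summable_const_div_add_one_sq 4) fun n θ => abs_tentTerm_le δ n θ))

theorem periodicTent_sub_int_mul_two_pi (δ θ : ℝ) (z : ℤ) :
    periodicTent δ (θ - z * (2 * Real.pi)) = periodicTent δ θ := by
  have h (n : ℕ) : tentTerm δ n (θ - z * (2 * Real.pi)) = tentTerm δ n θ := by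
    have e : ((n : ℝ) + 1) * (θ - z * (2 * Real.pi)) =
        (n + 1) * θ - ((n + 1) * z : ℤ) * (2 * Real.pi) := by
      push_cast
      ring
    rw [tentTerm, e, Real.cos_sub_int_mul_two_pi, tentTerm]
  simp only [periodicTent, h]

/-- The factor `2 - 2 * cos ((n + 1) * δ)` makes the cosine series a second difference with step `δ`
of the `B₂` series. The constants cancel, the quadratic parts leave `-δ ^ 2 / 2`, which the
definition compensates, and the absolute values form the tent. The hypothesis keeps all three
arguments within `[-2π, 2π]`. -/
theorem periodicTent_eq {δ θ : ℝ} (hδ : 0 ≤ δ) (h : |θ| + δ ≤ 2 * Real.pi) :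
    periodicTent δ θ = (|θ + δ| + |θ - δ| - 2 * |θ|) / 2 := by
  have h0 : |θ| ≤ 2 * Real.pi := by linarith
  have h1 : |θ + δ| ≤ 2 * Real.pi := (abs_add_le _ _).trans (by rwa [abs_of_nonneg hδ])
  have h2 : |θ - δ| ≤ 2 * Real.pi := (abs_sub _ _).trans (by rwa [abs_of_nonneg hδ])
  have hs := (((hasSum_cos_mul_div_sq_of_abs_le h0).mul_left 2).sub
    (hasSum_cos_mul_div_sq_of_abs_le h1)).sub (hasSum_cos_mul_div_sq_of_abs_le h2)
  have e : (fun n => tentTerm δ n θ) = fun n : ℕ =>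
      2 * (Real.cos ((n + 1) * θ) / ((n : ℝ) + 1) ^ 2) -
        Real.cos ((n + 1) * (θ + δ)) / ((n : ℝ) + 1) ^ 2 -
        Real.cos ((n + 1) * (θ - δ)) / ((n : ℝ) + 1) ^ 2 := by
    funext n
    rw [tentTerm, mul_add, mul_sub, Real.cos_add, Real.cos_sub]
    ring
  rw [periodicTent, e, hs.tsum_eq]
  field_simp
  ring

theorem periodicTent_eq_linearTent {δ θ : ℝ} (hδ : 0 < δ) (h : |θ| + δ ≤ 2 * Real.pi) :
    δ⁻¹ * periodicTent δ θ = linearTent (δ⁻¹ * θ) := by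
  have e (t : ℝ) : |δ⁻¹ * t| = δ⁻¹ * |t| := by rw [abs_mul, abs_of_pos (inv_pos.2 hδ)]
  have e1 : δ⁻¹ * θ + 1 = δ⁻¹ * (θ + δ) := by field_simp
  have e2 : δ⁻¹ * θ - 1 = δ⁻¹ * (θ - δ) := by field_simp
  rw [periodicTent_eq hδ.le h, linearTent, e1, e2, e, e, e]
  ring

theorem linearTent_nonneg (u : ℝ) : 0 ≤ linearTent u := by
  have h := abs_add_le (u + 1) (u - 1)
  have e : u + 1 + (u - 1) = 2 * u := by ring
  rw [e, abs_mul, abs_two] at h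
  rw [linearTent]
  linarith

theorem linearTent_eq_zero {u : ℝ} (hu : 1 ≤ |u|) : linearTent u = 0 := by
  rw [linearTent]
  rcases le_abs.1 hu with h | h
  · rw [abs_of_nonneg (by linarith : 0 ≤ u + 1), abs_of_nonneg (by linarith : 0 ≤ u - 1),
      abs_of_nonneg (by linarith : 0 ≤ u)]
    ring
  · rw [abs_of_nonpos (by linarith : u + 1 ≤ 0), abs_of_nonpos (by linarith : u - 1 ≤ 0),
      abs_of_nonpos (by linarith : u ≤ 0)]
    ring

/-- The tent is a second difference of `|u| / 2`, so the sum of its integer translates telescopes to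
first differences. -/
theorem sum_range_linearTent (u : ℝ) (N : ℕ) :
    ∑ j ∈ Finset.range N, linearTent (u - j) =
      ((|u + 1| - |u|) - (|u - N + 1| - |u - N|)) / 2 := by
  have h := Finset.sum_range_sub' (fun j : ℕ => (|u - j + 1| - |u - j|) / 2) N
  have e (j : ℕ) : linearTent (u - j) = (|u - j + 1| - |u - j|) / 2 -
      (|u - (j + 1 : ℕ) + 1| - |u - (j + 1 : ℕ)|) / 2 := by
    push_cast
    rw [linearTent]
    ring_nf
  rw [Finset.sum_congr rfl fun j _ => e j, h]
  simp
  ring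

theorem sum_range_linearTent_le_one (u : ℝ) (N : ℕ) :
    ∑ j ∈ Finset.range N, linearTent (u - j) ≤ 1 := by
  have h1 := abs_sub_abs_le_abs_sub (u + 1) u
  have h2 := abs_sub_abs_le_abs_sub (u - N) (u - N + 1)
  rw [add_sub_cancel_left, abs_one] at h1
  rw [sub_add_cancel_left, abs_neg, abs_one] at h2
  rw [sum_range_linearTent]
  linarith

theorem sum_range_linearTent_eq_one {u : ℝ} {N : ℕ} (h0 : 0 ≤ u) (h1 : u ≤ N) :
    ∑ j ∈ Finset.range (N + 1), linearTent (u - j) = 1 := by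
  rw [sum_range_linearTent]
  push_cast
  rw [abs_of_nonneg h0, abs_of_nonneg (by linarith : 0 ≤ u + 1),
    abs_of_nonpos (by linarith : u - (N + 1) + 1 ≤ 0),
    abs_of_nonpos (by linarith : u - (N + 1) ≤ 0)]
  ring

end PeriodicTent

/-! ### Piecewise linear interpolation and its periodic version. -/

section Interpolation

/-- The `j`-th node of the grid of mesh `1 / D` starting at `-L`. -/
def gridNode (L D j : ℕ) : ℚ := j * ((D : ℚ)⁻¹) - L

/-- The piecewise linear interpolation of `f` on `[-L, L]` with mesh `1 / D`. -/
noncomputable def gridInterpolant (f : ℝ → ℝ) (L D : ℕ) (x : ℝ) : ℝ :=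
  ∑ j ∈ Finset.range (2 * L * D + 1), f (gridNode L D j) * linearTent (D * x + L * D - j)

/-- A `2πR`-periodic version of the piecewise linear interpolation. -/
noncomputable def periodicInterpolant (f : ℝ → ℝ) (L D R : ℕ) (x : ℝ) : ℝ :=
  ∑ j ∈ Finset.range (2 * L * D + 1), f (gridNode L D j) * ((D * R : ℕ) *
    periodicTent ((D * R : ℕ) : ℝ)⁻¹ ((R : ℝ)⁻¹ * x - (R : ℝ)⁻¹ * gridNode L D j))

variable {f : ℝ → ℝ} {L D R : ℕ}

theorem abs_gridNode_le (hD : 0 < D) {j : ℕ} (hj : j ∈ Finset.range (2 * L * D + 1)) :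
    |(gridNode L D j : ℝ)| ≤ L := by
  have hD' : (0 : ℝ) < D := by exact_mod_cast hD
  have hj : (j : ℝ) ≤ 2 * L * D := by exact_mod_cast Nat.lt_succ_iff.1 (Finset.mem_range.1 hj)
  have h1 : (j : ℝ) * (D : ℝ)⁻¹ ≤ 2 * L := by
    rw [← div_eq_mul_inv]
    exact (div_le_iff₀ hD').2 hj
  have h2 : 0 ≤ (j : ℝ) * (D : ℝ)⁻¹ := by positivity
  rw [gridNode]
  push_cast
  rw [abs_le]
  constructor <;> linarith

theorem abs_sub_gridInterpolant_le (hD : 0 < D) {ε : ℝ} (hε : 0 ≤ ε)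
    (hf0 : ∀ x, (L : ℝ) ≤ |x| → f x = 0)
    (hf : ∀ x y : ℝ, |x| ≤ L + 1 → |y| ≤ L + 1 → |x - y| < (D : ℝ)⁻¹ → |f x - f y| ≤ ε) (x : ℝ) :
    |f x - gridInterpolant f L D x| ≤ ε := by
  have hD' : (0 : ℝ) < D := by exact_mod_cast hD
  set T : ℕ → ℝ := fun j => linearTent (D * x + L * D - j) with hT
  -- The tents sum to one only over `[-L, L]`; elsewhere `f x` vanishes. Hence the error is a
  -- weighted sum of the differences between `f x` and the node values.
  have h1 : f x * (1 - ∑ j ∈ Finset.range (2 * L * D + 1), T j) = 0 := by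
    rcases le_total (L : ℝ) |x| with h | h
    · rw [hf0 x h, zero_mul]
    · obtain ⟨h2, h3⟩ := abs_le.1 h
      rw [hT, sum_range_linearTent_eq_one (by nlinarith) (by push_cast; nlinarith), sub_self,
        mul_zero]
  have h2 : f x - gridInterpolant f L D x =
      ∑ j ∈ Finset.range (2 * L * D + 1), T j * (f x - f (gridNode L D j)) := by
    have : ∑ j ∈ Finset.range (2 * L * D + 1), T j * (f x - f (gridNode L D j)) =
        f x * ∑ j ∈ Finset.range (2 * L * D + 1), T j - gridInterpolant f L D x := by
      rw [gridInterpolant, Finset.mul_sum, ← Finset.sum_sub_distrib]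
      exact Finset.sum_congr rfl fun j _ => by ring
    rw [this]
    linarith
  rw [h2]
  refine (Finset.abs_sum_le_sum_abs _ _).trans ?_
  calc ∑ j ∈ Finset.range (2 * L * D + 1), |T j * (f x - f (gridNode L D j))|
      ≤ ∑ j ∈ Finset.range (2 * L * D + 1), T j * ε := by
        refine Finset.sum_le_sum fun j hj => ?_
        have hT0 : 0 ≤ T j := linearTent_nonneg _
        rw [abs_mul, abs_of_nonneg hT0]
        rcases le_or_gt 1 |D * x + L * D - j| with h | h
        · have : T j = 0 := linearTent_eq_zero h
          simp [this]
        · refine mul_le_mul_of_nonneg_left ?_ hT0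
          have hg := abs_gridNode_le hD hj
          have e : (D : ℝ) * x + L * D - j = D * (x - gridNode L D j) := by
            rw [gridNode]
            push_cast
            field_simp
            ring
          rw [e, abs_mul, abs_of_pos hD'] at h
          have h3 : |x - gridNode L D j| < (D : ℝ)⁻¹ := by
            rw [← one_div, lt_div_iff₀ hD']
            linarith
          -- Here `x` may lie outside `[-L, L]`, but by less than `1 / D ≤ 1`; this is why the
          -- modulus is taken on `[-(L + 1), L + 1]`.
          refine hf _ _ ?_ (hg.trans (by linarith)) h3
          have h4 := abs_sub_abs_le_abs_sub x (gridNode L D j)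
          have h5 : (D : ℝ)⁻¹ ≤ 1 := inv_le_one_of_one_le₀ (by exact_mod_cast hD)
          linarith
    _ = (∑ j ∈ Finset.range (2 * L * D + 1), T j) * ε := by rw [Finset.sum_mul]
    _ ≤ 1 * ε := by
        gcongr
        exact sum_range_linearTent_le_one _ _
    _ = ε := one_mul ε

theorem abs_gridInterpolant_le {M : ℝ} (hM : ∀ x, |f x| ≤ M) (x : ℝ) :
    |gridInterpolant f L D x| ≤ M := by
  have hM0 : 0 ≤ M := (abs_nonneg _).trans (hM 0)
  refine (Finset.abs_sum_le_sum_abs _ _).trans ?_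
  calc ∑ j ∈ Finset.range (2 * L * D + 1),
        |f (gridNode L D j) * linearTent (D * x + L * D - j)|
      ≤ ∑ j ∈ Finset.range (2 * L * D + 1), M * linearTent (D * x + L * D - j) := by
        refine Finset.sum_le_sum fun j _ => ?_
        rw [abs_mul, abs_of_nonneg (linearTent_nonneg _)]
        exact mul_le_mul_of_nonneg_right (hM _) (linearTent_nonneg _)
    _ = M * ∑ j ∈ Finset.range (2 * L * D + 1), linearTent (D * x + L * D - j) := by
        rw [Finset.mul_sum]
    _ ≤ M := mul_le_of_le_one_right hM0 (sum_range_linearTent_le_one _ _)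

/-- After scaling by `1 / R`, nodes and half-width are at most `1`, so `π + 1 + 1 ≤ 2π` places every
tent in the range of `periodicTent_eq_linearTent`. -/
theorem periodicInterpolant_eq_gridInterpolant (hD : 0 < D) (hR : L + 1 ≤ R) {x : ℝ}
    (hx : |(R : ℝ)⁻¹ * x| ≤ Real.pi) :
    periodicInterpolant f L D R x = gridInterpolant f L D x := by
  have hD' : (1 : ℝ) ≤ D := by exact_mod_cast hD
  have hR' : (L : ℝ) + 1 ≤ R := by exact_mod_cast hR
  have hL0 : (0 : ℝ) ≤ L := by positivity
  have hR0 : (0 : ℝ) < R := by linarith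
  have hδ0 : (0 : ℝ) < ((D * R : ℕ) : ℝ)⁻¹ := by
    push_cast
    positivity
  have hδ1 : ((D * R : ℕ) : ℝ)⁻¹ ≤ 1 := by
    refine inv_le_one_of_one_le₀ ?_
    push_cast
    nlinarith
  refine Finset.sum_congr rfl fun j hj => ?_
  have hg : |(R : ℝ)⁻¹ * gridNode L D j| ≤ 1 := by
    rw [abs_mul, abs_of_pos (inv_pos.2 hR0), inv_mul_le_iff₀ hR0]
    linarith [abs_gridNode_le hD hj]
  have h := periodicTent_eq_linearTent hδ0
    (θ := (R : ℝ)⁻¹ * x - (R : ℝ)⁻¹ * gridNode L D j) (by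
      have := abs_sub ((R : ℝ)⁻¹ * x) ((R : ℝ)⁻¹ * gridNode L D j)
      linarith [Real.pi_gt_three])
  rw [inv_inv] at h
  rw [h]
  congr 2
  rw [gridNode]
  push_cast
  field_simp
  ring

/-- Periodicity moves `x` into the period where the interpolant is the plain one. The bound is
needed in the tail, where the periodic copies do not approximate `f`. -/
theorem abs_periodicInterpolant_le (hD : 0 < D) (hR : L + 1 ≤ R) {M : ℝ}
    (hM : ∀ x, |f x| ≤ M) (x : ℝ) : |periodicInterpolant f L D R x| ≤ M := by
  have hR0 : (R : ℝ) ≠ 0 := by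
    have : R ≠ 0 := by omega
    exact_mod_cast this
  have hπ := Real.pi_pos
  set z : ℤ := round ((R : ℝ)⁻¹ * x / (2 * Real.pi))
  set x' : ℝ := x - R * (z * (2 * Real.pi))
  have hx' : (R : ℝ)⁻¹ * x' = (R : ℝ)⁻¹ * x - z * (2 * Real.pi) := by
    simp only [x']
    field_simp
  have h1 : periodicInterpolant f L D R x = periodicInterpolant f L D R x' := by
    refine Finset.sum_congr rfl fun j _ => ?_
    rw [hx', sub_right_comm, periodicTent_sub_int_mul_two_pi]
  have h2 : |(R : ℝ)⁻¹ * x'| ≤ Real.pi := by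
    have h3 := abs_sub_round ((R : ℝ)⁻¹ * x / (2 * Real.pi))
    have e : (R : ℝ)⁻¹ * x - z * (2 * Real.pi) =
        ((R : ℝ)⁻¹ * x / (2 * Real.pi) - z) * (2 * Real.pi) := by
      field_simp
    rw [hx', e, abs_mul, abs_of_pos (by positivity : 0 < 2 * Real.pi)]
    nlinarith
  rw [h1, periodicInterpolant_eq_gridInterpolant hD hR h2]
  exact abs_gridInterpolant_le hM x'

theorem continuous_periodicInterpolant : Continuous (periodicInterpolant f L D R) := by
  refine continuous_finsetSum _ fun j _ => continuous_const.mul (continuous_const.mul ?_)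
  exact (continuous_periodicTent _).comp (by fun_prop)

end Interpolation

/-! ### Tails and integrals expressed through the characteristic function. -/

section Measure

open MeasureTheory

variable {μ : Measure ℝ} [IsProbabilityMeasure μ]

theorem Continuous.integrable_of_abs_le {f : ℝ → ℝ} (hf : Continuous f) {M : ℝ}
    (hM : ∀ x, |f x| ≤ M) : Integrable f μ :=
  Integrable.of_bound hf.aestronglyMeasurable M (Filter.Eventually.of_forall hM)

theorem abs_integral_sub_le_of_abs_le {f g : ℝ → ℝ} (hf : Continuous f) (hg : Continuous g)
    {M ε r : ℝ} (hfM : ∀ x, |f x| ≤ M) (hgM : ∀ x, |g x| ≤ M) (hε : 0 ≤ ε)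
    (h : ∀ x, |x| ≤ r → |f x - g x| ≤ ε) :
    |∫ x, f x ∂μ - ∫ x, g x ∂μ| ≤ ε + 2 * M * μ.real {x | r < |x|} := by
  have hM0 : 0 ≤ M := (abs_nonneg _).trans (hfM 0)
  have hs : MeasurableSet {x : ℝ | r < |x|} :=
    measurableSet_lt measurable_const continuous_abs.measurable
  rw [← integral_sub (hf.integrable_of_abs_le hfM) (hg.integrable_of_abs_le hgM)]
  have hi : Integrable ({x : ℝ | r < |x|}.indicator fun _ => 2 * M) μ :=
    (integrable_const _).indicator hs
  have hb : ∀ x, ‖f x - g x‖ ≤ ε + {x : ℝ | r < |x|}.indicator (fun _ => 2 * M) x := by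
    intro x
    rw [Real.norm_eq_abs]
    by_cases hx : r < |x|
    · rw [Set.indicator_of_mem (by exact hx)]
      have := abs_sub (f x) (g x)
      linarith [hfM x, hgM x]
    · rw [Set.indicator_of_notMem (by exact hx), add_zero]
      exact h x (not_lt.1 hx)
  refine (norm_integral_le_of_norm_le ((integrable_const ε).add hi)
    (Filter.Eventually.of_forall hb)).trans ?_
  rw [integral_add' (integrable_const ε) hi, integral_indicator_const _ hs]
  simp [mul_comm]

/-- Quantitative tightness: the tail is at most `r / 2` times the norm of the integral of `1 -
charFun μ` over an interval of length `4 / r`. -/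
theorem measureReal_abs_gt_le_of_charFun {r ε : ℝ} (hr : 0 < r)
    (h : ∀ t, |t| ≤ 2 * r⁻¹ → ‖1 - charFun μ t‖ ≤ ε) : μ.real {x | r < |x|} ≤ 2 * ε := by
  refine (measureReal_abs_gt_le_integral_charFun hr).trans ?_
  have hle : -2 * r⁻¹ ≤ 2 * r⁻¹ := by nlinarith [inv_pos.2 hr]
  have hn := intervalIntegral.norm_integral_le_of_norm_le_const (a := -2 * r⁻¹) (b := 2 * r⁻¹)
    (f := fun t => 1 - charFun μ t) (C := ε) fun t ht => by
      rw [Set.uIoc_of_le hle] at ht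
      exact h t (abs_le.2 ⟨by linarith [ht.1], ht.2⟩)
  have e : |2 * r⁻¹ - -2 * r⁻¹| = 4 * r⁻¹ := by
    rw [abs_of_nonneg (by linarith)]
    ring
  rw [e] at hn
  calc 2⁻¹ * r * ‖∫ t in (-2 * r⁻¹)..(2 * r⁻¹), 1 - charFun μ t‖
      ≤ 2⁻¹ * r * (ε * (4 * r⁻¹)) := by gcongr
    _ = 2 * ε := by
      field_simp
      ring

theorem integrable_exp_mul_mul_I (t : ℝ) :
    Integrable (fun x : ℝ => Complex.exp (t * x * Complex.I)) μ := by
  refine Integrable.of_bound (by fun_prop) 1 (Filter.Eventually.of_forall fun x => ?_)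
  rw [← Complex.ofReal_mul, Complex.norm_exp_ofReal_mul_I]

theorem re_charFun (t : ℝ) : (charFun μ t).re = ∫ x, Real.cos (t * x) ∂μ := by
  rw [charFun_apply_real]
  refine (Complex.reCLM.integral_comp_comm (integrable_exp_mul_mul_I t)).symm.trans
    (integral_congr_ae (Filter.Eventually.of_forall fun x => ?_))
  simp only [Complex.reCLM_apply]
  rw [← Complex.ofReal_mul, Complex.exp_ofReal_mul_I_re]

theorem im_charFun (t : ℝ) : (charFun μ t).im = ∫ x, Real.sin (t * x) ∂μ := by
  rw [charFun_apply_real]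
  refine (Complex.imCLM.integral_comp_comm (integrable_exp_mul_mul_I t)).symm.trans
    (integral_congr_ae (Filter.Eventually.of_forall fun x => ?_))
  simp only [Complex.imCLM_apply]
  rw [← Complex.ofReal_mul, Complex.exp_ofReal_mul_I_im]

theorem integral_cos_mul_sub (t a : ℝ) :
    ∫ x, Real.cos (t * x - a) ∂μ =
      Real.cos a * (charFun μ t).re + Real.sin a * (charFun μ t).im := by
  have hc : Integrable (fun x => Real.cos (t * x)) μ :=
    Continuous.integrable_of_abs_le (by fun_prop) fun x => Real.abs_cos_le_one _
  have hs : Integrable (fun x => Real.sin (t * x)) μ :=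
    Continuous.integrable_of_abs_le (by fun_prop) fun x => Real.abs_sin_le_one _
  rw [re_charFun, im_charFun, ← integral_const_mul, ← integral_const_mul,
    ← integral_add (hc.const_mul _) (hs.const_mul _)]
  refine integral_congr_ae (Filter.Eventually.of_forall fun x => ?_)
  simp only [Real.cos_sub]
  ring

theorem integral_tentTerm (δ h a : ℝ) (n : ℕ) :
    ∫ x, tentTerm δ n (h * x - a) ∂μ = (2 - 2 * Real.cos ((n + 1) * δ)) / ((n : ℝ) + 1) ^ 2 *
      (Real.cos ((n + 1) * a) * (charFun μ ((n + 1) * h)).re +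
        Real.sin ((n + 1) * a) * (charFun μ ((n + 1) * h)).im) := by
  rw [← integral_cos_mul_sub, ← integral_const_mul]
  refine integral_congr_ae (Filter.Eventually.of_forall fun x => ?_)
  simp only [tentTerm]
  ring_nf

theorem abs_integral_tentTerm_le (δ h a : ℝ) (n : ℕ) :
    |∫ x, tentTerm δ n (h * x - a) ∂μ| ≤ 4 / ((n : ℝ) + 1) ^ 2 := by
  refine (norm_integral_le_of_norm_le_const
    (Filter.Eventually.of_forall fun x =>
      (Real.norm_eq_abs _).trans_le (abs_tentTerm_le δ n (h * x - a)))).trans ?_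
  simp

/-- The bound `4 / (n + 1) ^ 2`, uniform in `x`, allows sum and integral to be exchanged. -/
theorem hasSum_integral_tentTerm (δ h a : ℝ) :
    HasSum (fun n => ∫ x, tentTerm δ n (h * x - a) ∂μ)
      (∫ x, ∑' n, tentTerm δ n (h * x - a) ∂μ) := by
  have hc (n : ℕ) : Continuous fun x => tentTerm δ n (h * x - a) :=
    (continuous_tentTerm δ n).comp (by fun_prop)
  refine hasSum_integral_of_summable_integral_norm
    (fun n => (hc n).integrable_of_abs_le fun x => abs_tentTerm_le δ n _)
    (Summable.of_nonneg_of_le (fun n => integral_nonneg fun x => norm_nonneg _) (fun n => ?_)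
      (summable_const_div_add_one_sq 4))
  refine (integral_mono_of_nonneg (Filter.Eventually.of_forall fun x => norm_nonneg _)
    (integrable_const (4 / ((n : ℝ) + 1) ^ 2))
    (Filter.Eventually.of_forall fun x => abs_tentTerm_le δ n _)).trans ?_
  simp

theorem integral_periodicTent (δ h a : ℝ) :
    ∫ x, periodicTent δ (h * x - a) ∂μ =
      Real.pi⁻¹ * (δ ^ 2 / 2 + ∫ x, ∑' n, tentTerm δ n (h * x - a) ∂μ) := by
  have hc : Continuous fun x => ∑' n, tentTerm δ n (h * x - a) :=
    (continuous_tsum (continuous_tentTerm δ) (summable_const_div_add_one_sq 4)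
      fun n θ => abs_tentTerm_le δ n θ).comp (by fun_prop)
  have hi : Integrable (fun x => ∑' n, tentTerm δ n (h * x - a)) μ :=
    hc.integrable_of_abs_le  fun x => abs_tsum_tentTerm_le δ _
  simp only [periodicTent]
  rw [integral_const_mul, integral_add (integrable_const _) hi]
  simp

theorem integral_periodicInterpolant (f : ℝ → ℝ) (L D R : ℕ) :
    ∫ x, periodicInterpolant f L D R x ∂μ =
      ∑ j ∈ Finset.range (2 * L * D + 1), f (gridNode L D j) * ((D * R : ℕ) *
        ∫ x, periodicTent ((D * R : ℕ) : ℝ)⁻¹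
          ((R : ℝ)⁻¹ * x - (R : ℝ)⁻¹ * gridNode L D j) ∂μ) := by
  simp only [periodicInterpolant]
  rw [integral_finsetSum]
  · simp only [integral_const_mul]
  · intro j _
    refine (Integrable.const_mul ?_ _).const_mul _
    refine Continuous.integrable_of_abs_le (M := Real.pi⁻¹ * ((((D * R : ℕ) : ℝ)⁻¹) ^ 2 / 2 +
      ∑' n : ℕ, 4 / ((n : ℝ) + 1) ^ 2)) ((continuous_periodicTent _).comp (by fun_prop)) fun x => ?_
    rw [periodicTent, abs_mul, abs_of_pos (inv_pos.2 Real.pi_pos)]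
    gcongr
    exact (abs_add_le _ _).trans (add_le_add (abs_of_nonneg (by positivity)).le
      (abs_tsum_tentTerm_le _ _))

end Measure

/-! ### Computability of the integrals of periodic interpolants. -/

section Integrals

open MeasureTheory

variable {ι : Type*} [Primcodable ι] {μ : ℕ → Measure ℝ}

theorem ComputableComplexFunctions.re_charFun
    (hφ : ComputableComplexFunctions fun m t => charFun (μ m) t) {m : ι → ℕ} (hm : Computable m)
    {r : ι → ℚ} (hr : RecursiveRat r) :
    ComputableReals fun i => (charFun (μ (m i)) (r i)).re :=
  ComputableReals.eval_ratCast (f := fun m t => (charFun (μ m) t).re)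
    (fun x hx => (hφ.1 x hx).re) hm hr

theorem ComputableComplexFunctions.im_charFun
    (hφ : ComputableComplexFunctions fun m t => charFun (μ m) t) {m : ι → ℕ} (hm : Computable m)
    {r : ι → ℚ} (hr : RecursiveRat r) :
    ComputableReals fun i => (charFun (μ (m i)) (r i)).im :=
  ComputableReals.eval_ratCast (f := fun m t => (charFun (μ m) t).im)
    (fun x hx => (hφ.1 x hx).im) hm hr

/-- Each term of the integrated series involves only `cos` and `sin` at rationals and the
characteristic function at the rational `(n + 1) * h`. The bound `4 / (n + 1) ^ 2` does not depend
on the measure, so the convergence is effective uniformly in the index. -/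
theorem ComputableComplexFunctions.computableReals_integral_periodicTent
    (hμ : ∀ m, IsProbabilityMeasure (μ m))
    (hφ : ComputableComplexFunctions fun m t => charFun (μ m) t) {m : ι → ℕ} (hm : Computable m)
    {δ h a : ι → ℚ} (hδ : RecursiveRat δ) (hh : RecursiveRat h) (ha : RecursiveRat a) :
    ComputableReals fun i => ∫ x, periodicTent (δ i) (h i * x - a i) ∂(μ (m i)) := by
  have hn : RecursiveRat fun p : ι × ℕ => ((p.2 + 1 : ℕ) : ℚ) :=
    recursiveRat_natCast (Computable.succ.comp Computable.snd)
  have hinv : RecursiveRat fun p : ι × ℕ => ((p.2 : ℚ) + 1)⁻¹ :=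
    recursiveRat_inv_natCast_add_one Computable.snd
  have hm' : Computable fun p : ι × ℕ => m p.1 := hm.comp Computable.fst
  have hδn := hn.mul (hδ.comp Computable.fst)
  have hhn := hn.mul (hh.comp Computable.fst)
  have han := hn.mul (ha.comp Computable.fst)
  have two {κ : Type _} [Primcodable κ] : ComputableReals fun _ : κ => ((2 : ℕ) : ℝ) :=
    computableReals_natCast (Computable.const 2)
  have hu : ComputableReals fun p : ι × ℕ =>
      ∫ x, tentTerm (δ p.1) p.2 (h p.1 * x - a p.1) ∂(μ (m p.1)) := by
    refine (((two.sub (two.mul hδn.computableReals_cos)).mul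
      (hinv.mul hinv).computableReals).mul
      ((han.computableReals_cos.mul (hφ.re_charFun hm' hhn)).add
        (han.computableReals_sin.mul (hφ.im_charFun hm' hhn)))).of_eq fun p => ?_
    rw [integral_tentTerm, div_eq_mul_inv, sq ((p.2 : ℝ) + 1), mul_inv]
    push_cast
    ring
  have hsum : ComputableReals fun i =>
      ∫ x, ∑' n, tentTerm (δ i) n (h i * x - a i) ∂(μ (m i)) :=
    hu.of_hasSum (Computable.const 4) (fun i => hasSum_integral_tentTerm _ _ _)
      fun i n => abs_integral_tentTerm_le _ _ _ n
  have half := recursiveRat_inv_natCast_add_one (ι := ι) (Computable.const 1)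
  refine (computableReals_inv_pi.mul
    (((hδ.mul hδ).mul half).computableReals.add hsum)).of_eq fun i => ?_
  rw [integral_periodicTent]
  push_cast
  ring

theorem recursiveRat_inv_natCast {a : ι → ℕ} (ha : Computable a) (h : ∀ i, a i ≠ 0) :
    RecursiveRat fun i => ((a i : ℚ))⁻¹ :=
  ⟨fun _ => 0, fun _ => 1, a, Computable.const 0, Computable.const 1, ha, h, by simp⟩

theorem computableReals_integral_periodicInterpolant
    (hμ : ∀ m, IsProbabilityMeasure (μ m))
    (hφ : ComputableComplexFunctions fun m t => charFun (μ m) t) {f : ℕ → ℝ → ℝ}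
    (hf : ∀ x : ℕ → ℝ, ComputableReals x → ComputableReals fun p : ℕ × ℕ => f p.1 (x p.2))
    {m n L D R : ι → ℕ} (hm : Computable m) (hn : Computable n) (hL : Computable L)
    (hD : Computable D) (hR : Computable R) (hD0 : ∀ i, D i ≠ 0) (hR0 : ∀ i, R i ≠ 0) :
    ComputableReals fun i =>
      ∫ x, periodicInterpolant (f (n i)) (L i) (D i) (R i) x ∂(μ (m i)) := by
  have fst {g : ι → ℕ} (hg : Computable g) : Computable fun p : ι × ℕ => g p.1 :=
    hg.comp Computable.fst
  have hDR := (fst hD).fun_nat_mul (fst hR)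
  have hRinv := recursiveRat_inv_natCast (fst hR) fun p => hR0 p.1
  have hnode : RecursiveRat fun p : ι × ℕ => gridNode (L p.1) (D p.1) p.2 :=
    ((recursiveRat_natCast Computable.snd).mul
      (recursiveRat_inv_natCast (fst hD) fun p => hD0 p.1)).sub (recursiveRat_natCast (fst hL))
  have hN : Computable fun i => 2 * L i * D i + 1 :=
    ((((Computable.const 2).fun_nat_mul hL).fun_nat_mul hD).fun_nat_add (Computable.const 1))
  have hterm := (ComputableReals.eval_ratCast hf (fst hn) hnode).mul
    ((computableReals_natCast hDR).mul (hφ.computableReals_integral_periodicTent hμ (fst hm)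
      (recursiveRat_inv_natCast hDR fun p => mul_ne_zero (hD0 p.1) (hR0 p.1)) hRinv
      (hRinv.mul hnode)))
  refine (hterm.sum_range hN).of_eq fun i => ?_
  rw [integral_periodicInterpolant]
  push_cast
  rfl

end Integrals

/-! ### Continuity and recursive bounds from the modulus. -/

section Modulus

theorem EffectivelyContinuous.continuous {E : Type*} [NormedAddCommGroup E] {f : ℕ → ℝ → E}
    (hf : EffectivelyContinuous f) (n : ℕ) : Continuous (f n) := by
  obtain ⟨α, -, h⟩ := hf
  rw [Metric.continuous_iff]
  intro x ε hε
  obtain ⟨L, hL⟩ := exists_nat_ge (|x| + 1)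
  obtain ⟨k, hk⟩ := exists_pow_lt_of_lt_one hε (by norm_num : (2⁻¹ : ℝ) < 1)
  rw [inv_pow] at hk
  refine ⟨min 1 (2 ^ α (n, L, k))⁻¹, by positivity, fun y hy => ?_⟩
  rw [Real.dist_eq, lt_min_iff] at hy
  rw [dist_eq_norm]
  refine (h n L k y x ?_ (by linarith) hy.2).trans hk
  linarith [abs_sub_abs_le_abs_sub y x]

/-- A function that vanishes at `L` and varies by at most one over steps of length less than
`s` is bounded on `[-L, L]` by the number of steps needed. -/
theorem abs_le_of_step {f : ℝ → ℝ} {L s : ℝ} (hs : 0 < s) (hL : f L = 0)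
    (h : ∀ x y : ℝ, |x| ≤ L → |y| ≤ L → |x - y| < s → |f x - f y| ≤ 1) (N : ℕ) :
    ∀ x, |x| ≤ L → L - x ≤ N * (s / 2) → |f x| ≤ N := by
  induction N with
  | zero =>
    intro x hx hN
    have : x = L := le_antisymm (le_of_abs_le hx) (by simpa using hN)
    simp [this, hL]
  | succ N ih =>
    intro x hx hN
    push_cast at hN ⊢
    obtain ⟨h1, h2⟩ := abs_le.1 hx
    -- Steps of `s / 2` satisfy the strict inequality `< s`, and the minimum with `L` keeps the last
    -- one inside the interval.
    have hy : |min L (x + s / 2)| ≤ L :=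
      abs_le.2 ⟨le_min (by linarith) (by linarith), min_le_left _ _⟩
    have hN0 : 0 ≤ (N : ℝ) * (s / 2) := by positivity
    have h3 := ih (min L (x + s / 2)) hy (by
      rcases min_choice L (x + s / 2) with e | e <;> rw [e] <;> linarith)
    have h4 := h x (min L (x + s / 2)) hx hy (by
      rw [abs_sub_lt_iff]
      constructor
      · linarith [le_min h2 (by linarith : x ≤ x + s / 2)]
      · linarith [min_le_right L (x + s / 2)])
    linarith [abs_sub_abs_le_abs_sub (f x) (f (min L (x + s / 2)))]

theorem ComputableCompactSupport.exists_natCast_bound {f : ℕ → ℝ → ℝ} {L : ℕ → ℕ}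
    (hf : ComputableCompactSupport f L) :
    ∃ M : ℕ → ℕ, Computable M ∧ ∀ n x, |f n x| ≤ M n := by
  obtain ⟨⟨-, α, hα, h⟩, hL, h0⟩ := hf
  have hαn : Computable fun n => α (n, L n, 0) :=
    hα.comp (Computable.id.pair (hL.pair (Computable.const 0)))
  -- An interval of length `2 * L n` is crossed in `4 * L n * 2 ^ α` steps of half of `2 ^ (-α)`,
  -- and each step changes `f n` by at most `1 = 2 ^ 0`.
  refine ⟨fun n => 4 * L n * 2 ^ α (n, L n, 0), ((Computable.const 4).fun_nat_mul hL).fun_nat_mul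
    ((Computable.const 2).fun_nat_pow hαn), fun n x => ?_⟩
  rcases le_total (L n : ℝ) |x| with hx | hx
  · rw [h0 n x hx]
    simp
  · refine abs_le_of_step (s := (2 ^ α (n, L n, 0))⁻¹) (by positivity)
      (h0 n (L n) (le_abs_self _)) (fun x y hx hy hxy => ?_) _ x hx ?_
    · simpa using (h n (L n) 0 x y hx hy hxy).le
    · push_cast
      field_simp
      linarith [neg_abs_le x]

end Modulus

/-! ### Choice of the parameters and the final estimate. -/

theorem theorem4p5 (μ : ℕ → MeasureTheory.Measure ℝ)
    (hμ : ∀ m, MeasureTheory.IsProbabilityMeasure (μ m))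
    (hφ : ComputableComplexFunctions fun m t => MeasureTheory.charFun (μ m) t) :
    ComputableDistributions μ := by
  intro f L hf
  obtain ⟨M, hM, hfM⟩ := hf.exists_natCast_bound
  have hfc := hf.1.2.continuous
  obtain ⟨⟨hfx, α, hα, hfα⟩, hL, hf0⟩ := hf
  obtain ⟨β, hβ, hφβ⟩ := hφ.2
  have one {κ : Type} [Primcodable κ] : Computable fun _ : κ => 1 := Computable.const 1
  have two {κ : Type} [Primcodable κ] : Computable fun _ : κ => 2 := Computable.const 2
  have hm : Computable fun p : (ℕ × ℕ) × ℕ => p.1.1 := Computable.fst.comp Computable.fst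
  have hn : Computable fun p : (ℕ × ℕ) × ℕ => p.1.2 := Computable.snd.comp Computable.fst
  have hk : Computable fun p : (ℕ × ℕ) × ℕ => p.2 := Computable.snd
  -- The mesh makes the interpolation error at most `2 ^ (-(k + 1))`, half of the allowance.
  set D : (ℕ × ℕ) × ℕ → ℕ := fun p => 2 ^ α (p.1.2, L p.1.2 + 1, p.2 + 1) with hDdef
  -- The tail costs at most `2 * M * (2 * 2 ^ (-K))`; since `M ≤ 2 ^ M`, this is at most `4 * 2 ^
  -- (-(k + 3))`, the other half.
  set K : (ℕ × ℕ) × ℕ → ℕ := fun p => p.2 + 3 + M p.1.2 with hKdef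
  -- The summand `L + 1` separates the periodic copies. The exponent `β + 2` gives `2 / R < 2 ^
  -- (-β)`, so the modulus on `[-1, 1]` covers all `t` in the tail estimate.
  set R : (ℕ × ℕ) × ℕ → ℕ := fun p => L p.1.2 + 1 + 2 ^ (β (p.1.1, 1, K p) + 2) with hRdef
  have hD : Computable D := two.fun_nat_pow (hα.comp (hn.pair
    (((hL.comp hn).fun_nat_add one).pair (hk.fun_nat_add one))))
  have hK : Computable K := (hk.fun_nat_add (Computable.const 3)).fun_nat_add (hM.comp hn)
  have hR : Computable R := ((hL.comp hn).fun_nat_add one).fun_nat_add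
    (two.fun_nat_pow ((hβ.comp (hm.pair (one.pair hK))).fun_nat_add two))
  have hD0 (p) : D p ≠ 0 := pow_ne_zero _ two_ne_zero
  have hR0 (p) : R p ≠ 0 := by simp [hRdef]
  refine (computableReals_integral_periodicInterpolant hμ hφ hfx hm hn (hL.comp hn) hD hR hD0
    hR0).of_effective_limit fun i k => ?_
  obtain ⟨m, n⟩ := i
  simp only
  set d := D ((m, n), k)
  set ρ := R ((m, n), k)
  have hd : 0 < d := Nat.pos_of_ne_zero (hD0 _)
  have hρL : L n + 1 ≤ ρ := Nat.le_add_right _ _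
  have hρ0 : (0 : ℝ) < ρ := by exact_mod_cast (Nat.succ_pos _).trans_le hρL
  have hinterp (x : ℝ) : |f n x - gridInterpolant (f n) (L n) d x| ≤ (2 ^ (k + 1))⁻¹ := by
    refine abs_sub_gridInterpolant_le hd (by positivity) (hf0 n) (fun x y hx hy hxy => ?_) x
    refine (hfα n (L n + 1) (k + 1) x y (by exact_mod_cast hx) (by exact_mod_cast hy) ?_).le
    simpa [d, hDdef] using hxy
  have hnear (x : ℝ) (hx : |x| ≤ ρ) :
      |f n x - periodicInterpolant (f n) (L n) d ρ x| ≤ (2 ^ (k + 1))⁻¹ := by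
    rw [periodicInterpolant_eq_gridInterpolant hd hρL]
    · exact hinterp x
    · rw [abs_mul, abs_of_pos (inv_pos.2 hρ0), inv_mul_le_iff₀ hρ0]
      nlinarith [Real.pi_gt_three]
  have htail : (μ m).real {x | (ρ : ℝ) < |x|} ≤ 2 * (2 ^ (k + 3 + M n))⁻¹ := by
    refine measureReal_abs_gt_le_of_charFun hρ0 fun t ht => ?_
    have hpow : (2 : ℝ) ^ (β (m, 1, k + 3 + M n) + 2) ≤ ρ := by
      simp only [ρ, hRdef, hKdef]
      push_cast
      linarith [Nat.cast_nonneg (α := ℝ) (L n)]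
    have ht' : |t| < (2 ^ β (m, 1, k + 3 + M n))⁻¹ := by
      refine ht.trans_lt ?_
      have hb : (0 : ℝ) < 2 ^ β (m, 1, k + 3 + M n) := by positivity
      rw [pow_add] at hpow
      rw [← div_eq_mul_inv, ← one_div, div_lt_div_iff₀ hρ0 hb]
      linarith
    have hle : ((2 : ℝ) ^ β (m, 1, k + 3 + M n))⁻¹ ≤ 1 :=
      inv_le_one_of_one_le₀ (one_le_pow₀ one_le_two)
    -- The comparison point is `0`, where the characteristic function of a probability measure
    -- equals `1`.
    have h := hφβ m 1 (k + 3 + M n) 0 t (by simp) (by push_cast; linarith)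
      (by rwa [zero_sub, abs_neg])
    simpa using h.le
  refine (abs_integral_sub_le_of_abs_le (hfc n) continuous_periodicInterpolant (hfM n)
    (abs_periodicInterpolant_le hd hρL (hfM n)) (by positivity) hnear).trans ?_
  have h1 := Nat.cast_mul_inv_two_pow_add_le (M n) (k + 3)
  have h2 : 2 * (M n : ℝ) * (μ m).real {x | (ρ : ℝ) < |x|} ≤
      2 * M n * (2 * (2 ^ (k + 3 + M n))⁻¹) := by gcongr
  have h3 : ((2 : ℝ) ^ (k + 1))⁻¹ = (2 ^ k)⁻¹ / 2 := by rw [pow_succ, mul_inv]; ring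
  have h4 : ((2 : ℝ) ^ (k + 3))⁻¹ = (2 ^ k)⁻¹ / 8 := by rw [pow_add, mul_inv]; ring
  rw [h4] at h1
  rw [h3]
  linarith
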